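/- Let $A$ be a finite-dimensional algebra over a field and let $\mathscr{A}=A\text{-mod}$ be the category of finitely generated left $A$-modules. Let $\mathscr{C}$ be a full additive subcategory of $\mathscr{A}$, closed under direct summands, which is contravariantly finite (every $M\in\mathscr{A}$ has a right $\mathscr{C}$-approximation, i.e. a morphism $C\to M$ with $C\in\mathscr{C}$ through which every morphism from an object of $\mathscr{C}$ to $M$ factors) and admissible (every right $\mathscr{C}$-approximation is an epimorphism). A complex $X^\bullet$ is called $\mathrm{Hom}_{\mathscr{A}}(\mathscr{C},-)$-exact (resp. $\mathrm{Hom}_{\mathscr{A}}(-,\mathscr{C})$-exact) if $\mathrm{Hom}_{\mathscr{A}}(C,X^\bullet)$ (resp. $\mathrm{Hom}_{\mathscr{A}}(X^\bullet,C)$) is acyclic for all $C\in\mathscr{C}$. Let $D^b_{\mathscr{C}}(\mathscr{A})$ be the Verdier quotient of the bounded homotopy category $K^b(\mathscr{A})$ by the $\mathrm{Hom}_{\mathscr{A}}(\mathscr{C},-)$-exact complexes, and let $D_{\mathscr{C}\text{-}sg}(\mathscr{A})=D^b_{\mathscr{C}}(\mathscr{A})/K^b(\mathscr{C})$ be the Verdier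 quotient by the full subcategory of objects isomorphic in $D^b_{\mathscr{C}}(\mathscr{A})$ to bounded complexes over $\mathscr{C}$. Let $\mathscr{G}(\mathscr{C})$ be the full subcategory of $\mathscr{A}$ of all objects isomorphic to $\mathrm{Im}(C^{-1}\to C^0)$ for some acyclic complex $C^\bullet$ of objects of $\mathscr{C}$ that is both $\mathrm{Hom}_{\mathscr{A}}(\mathscr{C},-)$-exact and $\mathrm{Hom}_{\mathscr{A}}(-,\mathscr{C})$-exact, and let $\varepsilon$ be the class of $\mathrm{Hom}_{\mathscr{A}}(\mathscr{C},-)$-exact complexes $0\to L\to M\to N\to 0$ with $L,M,N\in\mathscr{G}(\mathscr{C})$. The stable category $\underline{\mathscr{G}(\mathscr{C})}$ has the objects of $\mathscr{G}(\mathscr{C})$, and its morphisms are those of $\mathscr{G}(\mathscr{C})$ modulo the morphisms that factor through an object of $\mathscr{C}$. It carries the usual triangulated structure of the stable category of a Frobenius category: for each $X$ choose a sequence $0\to X\to I(X)\to SX\to 0$ in $\varepsilon$ with $I(X)\in\mathscr{C}$; the suspension is $X\mapsto SX$, and the distinguished triangles are those isomorphic to a triangle $X\xrightarrow{u}Y\xrightarrow{v}Z\xrightarrow{w}SX$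 where $u$ is a morphism of $\mathscr{G}(\mathscr{C})$, $Z$ is the pushout of $X\to I(X)$ along $u$, and $w$ is induced by $I(X)\to SX$ and $0:Y\to SX$. Let $\theta:\mathscr{G}(\mathscr{C})\to D_{\mathscr{C}\text{-}sg}(\mathscr{A})$ be the composition $\mathscr{G}(\mathscr{C})\hookrightarrow\mathscr{A}\to D^b_{\mathscr{C}}(\mathscr{A})\to D_{\mathscr{C}\text{-}sg}(\mathscr{A})$ (an object of $\mathscr{A}$ being viewed as a complex concentrated in degree $0$), and let $\theta':\underline{\mathscr{G}(\mathscr{C})}\to D_{\mathscr{C}\text{-}sg}(\mathscr{A})$ be the functor induced by $\theta$. Then: 1. $\theta$ is a $\partial$-functor: it is additive, and for all $L\xrightarrow{i}M\xrightarrow{p}N$ in $\varepsilon$ there are morphisms $\omega_{(i,p)}:\theta(N)\to\theta(L)[1]$, functorial with respect to morphisms of sequences in $\varepsilon$, such that $\theta(L)\xrightarrow{\theta(i)}\theta(M)\xrightarrow{\theta(p)}\theta(N)\xrightarrow{\omega_{(i,p)}}\theta(L)[1]$ is a distinguished triangle. 2. $\theta(C)=0$ for every $C\in\mathscr{C}$.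 3. $\theta'$ is a triangle functor: it is additive, and there is a natural isomorphism $\omega:\theta' S\cong[1]\theta'$ such that for every distinguished triangle $X\xrightarrow{u}Y\xrightarrow{v}Z\xrightarrow{w}SX$ of $\underline{\mathscr{G}(\mathscr{C})}$ the triangle $\theta'X\xrightarrow{\theta'u}\theta'Y\xrightarrow{\theta'v}\theta'Z\xrightarrow{\omega_X\circ\theta'w}(\theta'X)[1]$ is distinguished. -/

import Mathlib

open CategoryTheory CategoryTheory.Limits CategoryTheory.Pretriangulated Opposite
open scoped ZeroObject

universe v u

noncomputable section

namespace RelSing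

section

variable {𝒜 : Type u} [Category.{v} 𝒜] (C : ObjectProperty 𝒜)

/-- A morphism `f : X ⟶ M` with `X` in `C` through which every morphism from an object
of `C` to `M` factors. -/
def IsRightApproximation {X M : 𝒜} (f : X ⟶ M) : Prop :=
  C X ∧ ∀ ⦃X' : 𝒜⦄, C X' → ∀ g : X' ⟶ M, ∃ h : X' ⟶ X, h ≫ f = g

/-- `C` is contravariantly finite in `𝒜`: every object has a right `C`-approximation. -/
def IsContravariantlyFinite : Prop :=
  ∀ M : 𝒜, ∃ (X : 𝒜) (f : X ⟶ M), IsRightApproximation C f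

/-- `C` is admissible: it is contravariantly finite and every right `C`-approximation is epic. -/
def IsAdmissible : Prop :=
  IsContravariantlyFinite C ∧
    ∀ ⦃X M : 𝒜⦄ (f : X ⟶ M), IsRightApproximation C f → Epi f

end

variable {𝒜 : Type u} [Category.{v} 𝒜] [Abelian 𝒜] (C : ObjectProperty 𝒜)

/-- `K` is `Hom(C, -)`-exact (also called `C`-acyclic): the complex of abelian groups
`Hom(X, K)` is acyclic for all `X` in `C`. -/
def HomFromExact (K : CochainComplex 𝒜 ℤ) : Prop :=
  ∀ ⦃X : 𝒜⦄, C X →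
    (((preadditiveCoyoneda.obj (op X)).mapHomologicalComplex (ComplexShape.up ℤ)).obj K).Acyclic

/-- `K` is `Hom(-, C)`-exact: the complex of abelian groups `Hom(K, X)` is acyclic for all
`X` in `C`. -/
def HomToExact (K : CochainComplex 𝒜 ℤ) : Prop :=
  ∀ ⦃X : 𝒜⦄, C X →
    (((preadditiveYoneda.obj X).mapHomologicalComplex (ComplexShape.up ℤ).symm).obj K.op).Acyclic

variable {C} in
lemma HomFromExact.exists_lift {K : CochainComplex 𝒜 ℤ} (h : HomFromExact C K) {X : 𝒜}
    (hX : C X) {i j k : ℤ} (hij : i + 1 = j) (hjk : j + 1 = k) (f : X ⟶ K.X j)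
    (hf : f ≫ K.d j k = 0) : ∃ g : X ⟶ K.X i, g ≫ K.d i j = f := by
  have h1 := (HomologicalComplex.exactAt_iff' _ i j k (by simp; omega) (by simp; omega)).1 (h hX j)
  rw [ShortComplex.ab_exact_iff] at h1
  exact h1 f hf

variable {C} in
lemma homFromExact_of_exists_lift {K : CochainComplex 𝒜 ℤ}
    (h : ∀ ⦃X : 𝒜⦄, C X → ∀ (j : ℤ) (f : X ⟶ K.X j), f ≫ K.d j (j + 1) = 0 →
      ∃ g : X ⟶ K.X (j - 1), g ≫ K.d (j - 1) j = f) : HomFromExact C K := by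
  intro X hX j
  rw [HomologicalComplex.exactAt_iff' _ (j - 1) j (j + 1) (by simp) (by simp),
    ShortComplex.ab_exact_iff]
  exact fun f hf => h hX j f hf

variable {C} in
lemma HomToExact.exists_desc {K : CochainComplex 𝒜 ℤ} (h : HomToExact C K) {X : 𝒜}
    (hX : C X) {i j k : ℤ} (hij : i + 1 = j) (hjk : j + 1 = k) (f : K.X j ⟶ X)
    (hf : K.d i j ≫ f = 0) : ∃ g : K.X k ⟶ X, K.d j k ≫ g = f := by
  have h1 := (HomologicalComplex.exactAt_iff' _ k j i
    (ComplexShape.prev_eq' _ hjk) (ComplexShape.next_eq' _ hij)).1 (h hX j)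
  rw [ShortComplex.ab_exact_iff] at h1
  exact h1 f hf

variable {C} in
lemma homToExact_of_exists_desc {K : CochainComplex 𝒜 ℤ}
    (h : ∀ ⦃X : 𝒜⦄, C X → ∀ (j : ℤ) (f : K.X j ⟶ X), K.d (j - 1) j ≫ f = 0 →
      ∃ g : K.X (j + 1) ⟶ X, K.d j (j + 1) ≫ g = f) : HomToExact C K := by
  intro X hX j
  rw [HomologicalComplex.exactAt_iff' _ (j + 1) j (j - 1)
    (ComplexShape.prev_eq' _ rfl) (ComplexShape.next_eq' _ (sub_add_cancel j 1)),
    ShortComplex.ab_exact_iff]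
  exact fun f hf => h hX j f hf

/-! ### The bounded homotopy category and the bounded `C`-derived category -/

variable (𝒜) in
/-- The (classes of) bounded complexes in the homotopy category. -/
def bounded : ObjectProperty (HomotopyCategory 𝒜 (ComplexShape.up ℤ)) :=
  fun K => ∃ a b : ℤ, ∀ n : ℤ, (n < a ∨ b < n) → IsZero (K.as.X n)

lemma isZero_mappingCone {K L : CochainComplex 𝒜 ℤ} (f : K ⟶ L) {n : ℤ}
    (h₁ : IsZero (K.X (n + 1))) (h₂ : IsZero (L.X n)) :
    IsZero ((CochainComplex.mappingCone f).X n) := by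
  rw [CochainComplex.mappingCone.isZero_X_iff]
  exact ⟨h₁, h₂⟩

instance : (bounded 𝒜).ContainsZero where
  exists_zero := ⟨(HomotopyCategory.quotient _ _).obj 0,
    Functor.map_isZero _ (isZero_zero _), 0, 0, fun n _ =>
      (HomologicalComplex.eval 𝒜 (ComplexShape.up ℤ) n).map_isZero (isZero_zero _)⟩

instance : (bounded 𝒜).IsStableUnderShift ℤ where
  isStableUnderShiftBy n :=
    { le_shift := by
        rintro K ⟨a, b, h⟩
        obtain ⟨K : CochainComplex _ _, rfl⟩ := K.quotient_obj_surjective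
        rw [ObjectProperty.prop_shift_iff, HomotopyCategory.shift_quotient_obj]
        refine ⟨a - n, b - n, fun i hi => ?_⟩
        exact h (i + n) (by omega) }

/-- The third vertex of a distinguished triangle in the homotopy category is homotopy equivalent
to the cone of a representative of the first morphism. -/
lemma exists_iso_mappingCone (T : Triangle (HomotopyCategory 𝒜 (ComplexShape.up ℤ)))
    (hT : T ∈ distTriang _) : ∃ f : T.obj₁.as ⟶ T.obj₂.as,
      Nonempty (T.obj₃ ≅ (HomotopyCategory.quotient _ _).obj (CochainComplex.mappingCone f)) := by
  obtain ⟨f : T.obj₁.as ⟶ T.obj₂.as, hf⟩ :=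
    (HomotopyCategory.quotient 𝒜 (ComplexShape.up ℤ)).map_surjective T.mor₁
  refine ⟨f, ⟨Triangle.π₃.mapIso (isoTriangleOfIso₁₂ T _ hT
    (HomotopyCategory.mappingCone_triangleh_distinguished f) (Iso.refl _) (Iso.refl _) ?_)⟩⟩
  erw [Category.comp_id, Category.id_comp]
  exact hf.symm

instance : (bounded 𝒜).IsTriangulatedClosed₃ where
  ext₃' T hT := by
    rintro ⟨a, b, h⟩ ⟨a', b', h'⟩
    obtain ⟨f, ⟨e⟩⟩ := exists_iso_mappingCone T hT
    refine ⟨_, ⟨min (a - 1) a', max b b', fun n hn => ?_⟩, ⟨e⟩⟩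
    exact isZero_mappingCone f (h _ (by omega)) (h' _ (by omega))

instance : (bounded 𝒜).IsTriangulated where
  toIsTriangulatedClosed₂ := .of_isTriangulatedClosed₃

variable (𝒜) in
/-- The bounded homotopy category `K^b(𝒜)`. -/
abbrev Kb := (bounded 𝒜).FullSubcategory

/-- The `C`-acyclic complexes in `K^b(𝒜)`. -/
def acyclic : ObjectProperty (Kb 𝒜) := fun K => HomFromExact C K.obj.as

/-- `C`-acyclicity as vanishing under homological functors. -/
lemma acyclic_iff (K : Kb 𝒜) : acyclic C K ↔ ∀ ⦃X : 𝒜⦄, C X →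
    ((HomotopyCategory.subcategoryAcyclic AddCommGrpCat.{v}).inverseImage
      ((bounded 𝒜).ι ⋙ (preadditiveCoyoneda.obj (op X)).mapHomotopyCategory
        (ComplexShape.up ℤ))) K := by
  refine forall_congr' fun X => forall_congr' fun _ => ?_
  exact (HomotopyCategory.quotient_obj_mem_subcategoryAcyclic_iff_acyclic _).symm

instance : (acyclic C).IsClosedUnderIsomorphisms where
  of_iso e h := by
    rw [acyclic_iff] at h ⊢
    exact fun X hX => ObjectProperty.prop_of_iso _ e (h hX)

instance : (acyclic C).IsTriangulated where
  exists_zero := by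
    refine ⟨0, isZero_zero _, ?_⟩
    rw [acyclic_iff]
    exact fun X _ => ObjectProperty.prop_zero _
  isStableUnderShiftBy n :=
    { le_shift := fun K h => by
        rw [ObjectProperty.prop_shift_iff, acyclic_iff]
        rw [acyclic_iff] at h
        exact fun X hX => ObjectProperty.le_shift _ n _ (h hX) }
  toIsTriangulatedClosed₂ := .mk' (fun T hT h₁ h₃ => by
    rw [acyclic_iff] at h₁ h₃ ⊢
    exact fun X hX => ObjectProperty.ext_of_isTriangulatedClosed₂ _ T hT (h₁ hX) (h₃ hX))

/-- The bounded `C`-derived category `D^b_C(𝒜)`: the Verdier quotient of `K^b(𝒜)` by the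
`C`-acyclic complexes. -/
abbrev DbC := (acyclic C).trW.Localization

/-- The quotient functor `K^b(𝒜) ⥤ D^b_C(𝒜)`. -/
abbrev Qb : Kb 𝒜 ⥤ DbC C := (acyclic C).trW.Q


/-! ### `K^b(C)` and the `C`-singularity category -/

/-- The (classes of) bounded complexes of objects of `C` in the homotopy category. -/
def boundedOf : ObjectProperty (HomotopyCategory 𝒜 (ComplexShape.up ℤ)) :=
  fun K => (∃ a b : ℤ, ∀ n : ℤ, (n < a ∨ b < n) → IsZero (K.as.X n)) ∧ ∀ n : ℤ, C (K.as.X n)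

/-- `K^b(C)` as a (strictly) full subcategory of `K^b(𝒜)`. -/
def KbOf : ObjectProperty (Kb 𝒜) := (boundedOf C).isoClosure.inverseImage (bounded 𝒜).ι

lemma exists_homotopic_vanishing {K N : CochainComplex 𝒜 ℤ} (hK : ∀ n, C (K.X n))
    (hN : HomFromExact C N) (b : ℤ) (hb : ∀ n, b < n → IsZero (K.X n)) (f : K ⟶ N) (m : ℕ) :
    ∃ g : K ⟶ N, (HomotopyCategory.quotient 𝒜 (ComplexShape.up ℤ)).map f =
      (HomotopyCategory.quotient 𝒜 (ComplexShape.up ℤ)).map g ∧ ∀ i : ℤ, b - m < i → g.f i = 0 := by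
  induction m with
  | zero => exact ⟨f, rfl, fun i hi => (hb i (by simpa using hi)).eq_of_src _ _⟩
  | succ m ih =>
    obtain ⟨g, h, hg⟩ := ih
    obtain ⟨k, hk⟩ := hN.exists_lift (hK (b - m)) (i := b - m - 1) (k := b - m + 1)
      (by omega) rfl (g.f (b - m)) (by
        rw [HomologicalComplex.Hom.comm, hg _ (by omega), comp_zero])
    let e : ∀ i j : ℤ, (ComplexShape.up ℤ).Rel j i → (K.X i ⟶ N.X j) := fun i j hij =>
      if hi : i = b - m then
        eqToHom (by rw [hi]) ≫ k ≫ eqToHom (by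
          have : j = b - m - 1 := by have : j + 1 = i := hij; omega
          rw [this])
      else 0
    refine ⟨g - Homotopy.nullHomotopicMap' e, ?_, fun i hi => ?_⟩
    · rw [h, Functor.map_sub, HomotopyCategory.eq_of_homotopy _ _ (Homotopy.nullHomotopy' e),
        Functor.map_zero, sub_zero]
    · have r₁ : (ComplexShape.up ℤ).Rel (i - 1) i := sub_add_cancel i 1
      have r₂ : (ComplexShape.up ℤ).Rel i (i + 1) := rfl
      rw [HomologicalComplex.sub_f_apply, Homotopy.nullHomotopicMap'_f r₁ r₂]
      have e₁ : e (i + 1) i r₂ = 0 := dif_neg (by push_cast at hi; omega)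
      rw [e₁, comp_zero, zero_add]
      by_cases hi' : i = b - m
      · subst hi'
        have e₂ : e (b - m) (b - m - 1) r₁ = k := by
          simp [e]
        rw [e₂, hk, sub_self]
      · have e₂ : e i (i - 1) r₁ = 0 := dif_neg hi'
        rw [e₂, zero_comp, sub_zero, hg i (by push_cast at hi; omega)]

/-- There are no nonzero morphisms from `K^b(C)` to `C`-acyclic complexes. -/
lemma eq_zero_of_acyclic {K N : Kb 𝒜} (hK : KbOf C K) (hN : acyclic C N) (f : K ⟶ N) : f = 0 := by
  obtain ⟨L, ⟨⟨a, b, hab⟩, hL⟩, ⟨e⟩⟩ := hK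
  obtain ⟨f₀ : L.as ⟶ N.obj.as, hf₀⟩ :=
    (HomotopyCategory.quotient 𝒜 (ComplexShape.up ℤ)).map_surjective (e.inv ≫ f.hom)
  obtain ⟨g, h, hg⟩ := exists_homotopic_vanishing C hL hN b (fun n hn => hab n (Or.inr hn)) f₀
    (b - a + 1).toNat
  have hg0 : g = 0 := by
    ext i
    by_cases hi : b - (b - a + 1).toNat < i
    · exact hg i hi
    · exact (hab i (Or.inl (by omega))).eq_of_src _ _
  have h0 : e.inv ≫ f.hom = 0 := by
    refine hf₀.symm.trans (h.trans ?_)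
    rw [hg0, Functor.map_zero]
    rfl
  apply ObjectProperty.hom_ext
  rw [← cancel_epi e.inv]
  exact h0.trans comp_zero.symm

lemma boundedOf_isStableUnderShift : (boundedOf C).IsStableUnderShift ℤ where
  isStableUnderShiftBy n :=
    { le_shift := by
        rintro K ⟨⟨a, b, h⟩, hC⟩
        obtain ⟨K : CochainComplex _ _, rfl⟩ := K.quotient_obj_surjective
        rw [ObjectProperty.prop_shift_iff, HomotopyCategory.shift_quotient_obj]
        exact ⟨⟨a - n, b - n, fun i hi => h (i + n) (by omega)⟩, fun i => hC (i + n)⟩ }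

section

variable [C.IsClosedUnderFiniteProducts]

lemma prop_mappingCone {K L : CochainComplex 𝒜 ℤ} (f : K ⟶ L) (hK : ∀ n, C (K.X n))
    (hL : ∀ n, C (L.X n)) (n : ℤ) : C ((CochainComplex.mappingCone f).X n) := by
  have := ObjectProperty.IsClosedUnderBinaryProducts.closedUnderIsomorphisms C
  refine C.prop_of_iso (HomologicalComplex.homotopyCofiber.XIsoBiprod f n (n + 1) rfl).symm ?_
  exact C.prop_of_iso (biprod.isoProd _ _).symm (C.prop_prod _ _ (hK _) (hL _))

instance : (boundedOf C).IsTriangulated where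
  exists_zero := by
    have h0 (n : ℤ) : IsZero ((0 : CochainComplex 𝒜 ℤ).X n) :=
      (HomologicalComplex.eval 𝒜 (ComplexShape.up ℤ) n).map_isZero (isZero_zero _)
    exact ⟨(HomotopyCategory.quotient _ _).obj 0, Functor.map_isZero _ (isZero_zero _),
      ⟨0, 0, fun n _ => h0 n⟩, fun n => C.prop_of_isTerminal _ (h0 n).isTerminal⟩
  toIsStableUnderShift := boundedOf_isStableUnderShift C
  toIsTriangulatedClosed₂ := by
    have : (boundedOf C).IsTriangulatedClosed₃ := ⟨fun T hT => by
      rintro ⟨⟨a, b, h⟩, h₁⟩ ⟨⟨a', b', h'⟩, h₂⟩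
      obtain ⟨f, ⟨e⟩⟩ := exists_iso_mappingCone T hT
      refine ⟨_, ⟨⟨min (a - 1) a', max b b', fun n hn => ?_⟩, ?_⟩, ⟨e⟩⟩
      · exact isZero_mappingCone f (h _ (by omega)) (h' _ (by omega))
      · exact prop_mappingCone C f h₁ h₂⟩
    have := boundedOf_isStableUnderShift C
    exact .of_isTriangulatedClosed₃

instance : (KbOf C).IsTriangulated := by
  unfold KbOf
  infer_instance

instance : ((KbOf C).ι ⋙ Qb C).Full where
  map_surjective {X Y} g := by
    obtain ⟨φ, hφ⟩ := Localization.exists_rightFraction (Qb C) (acyclic C).trW g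
    obtain ⟨N, a, b, hT, hN⟩ := (acyclic C).trW_iff φ.s |>.1 φ.hs
    obtain ⟨t, ht⟩ : ∃ t : X.obj ⟶ φ.X', 𝟙 X.obj = t ≫ φ.s :=
      Triangle.coyoneda_exact₂ _ hT (𝟙 X.obj) (eq_zero_of_acyclic C X.property hN _)
    refine ⟨(KbOf C).homMk (t ≫ φ.f), ?_⟩
    have := Localization.inverts (Qb C) (acyclic C).trW φ.s φ.hs
    rw [hφ, ← cancel_epi ((Qb C).map φ.s), MorphismProperty.RightFraction.map_s_comp_map]
    have h2 : (Qb C).map φ.s ≫ (Qb C).map t = 𝟙 _ := by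
      rw [← cancel_mono ((Qb C).map φ.s), Category.assoc, ← Functor.map_comp]
      rw [← ht]
      simp
    change (Qb C).map φ.s ≫ (Qb C).map (t ≫ φ.f) = _
    rw [Functor.map_comp, reassoc_of% h2]

/-- `K^b(C)` viewed as a full subcategory of `D^b_C(𝒜)`: the objects isomorphic to the image
of a bounded complex of objects of `C`. -/
def KbOfInDbC : ObjectProperty (DbC C) := (KbOf C).map (Qb C)

instance : (KbOfInDbC C).IsTriangulated := by
  unfold KbOfInDbC
  rw [← Functor.essImage_ι_comp]
  infer_instance

/-- The `C`-singularity category: the Verdier quotient `D^b_C(𝒜) / K^b(C)`. -/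
abbrev Dsg := (KbOfInDbC C).trW.Localization

/-- The localization functor `D^b_C(𝒜) ⥤ D_{C-sg}(𝒜)`. -/
abbrev Qsg : DbC C ⥤ Dsg C := (KbOfInDbC C).trW.Q

instance (n : ℤ) : (shiftFunctor (Dsg C) n).Additive :=
  Triangulated.Localization.instAdditiveLocalizationShiftFunctorInt (KbOfInDbC C).trW n


variable (𝒜) in
/-- The functor `𝒜 ⥤ K^b(𝒜)` sending an object to the complex concentrated in degree `0`. -/
def toKb : 𝒜 ⥤ Kb 𝒜 :=
  (bounded 𝒜).lift (HomotopyCategory.singleFunctor 𝒜 0) (fun X => ⟨0, 0, fun n hn =>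
    HomologicalComplex.isZero_single_obj_X (ComplexShape.up ℤ) 0 X n (by omega)⟩)

instance : (toKb 𝒜).Additive := by
  constructor
  intro X Y f g
  apply ObjectProperty.hom_ext
  exact (HomotopyCategory.singleFunctor 𝒜 0).map_add

/-- The functor `𝒜 ⥤ D^b_C(𝒜) ⥤ D_{C-sg}(𝒜)`. -/
def toDsg : 𝒜 ⥤ Dsg C := toKb 𝒜 ⋙ Qb C ⋙ Qsg C

instance : (toDsg C).Additive := by
  unfold toDsg
  infer_instance

lemma isZero_toDsg {X : 𝒜} (hX : C X) : IsZero ((toDsg C).obj X) := by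
  have h : KbOf C ((toKb 𝒜).obj X) := by
    refine ObjectProperty.le_isoClosure _ _ ⟨((toKb 𝒜).obj X).property, fun n => ?_⟩
    have := ObjectProperty.IsClosedUnderBinaryProducts.closedUnderIsomorphisms C
    by_cases hn : n = 0
    · subst hn
      exact C.prop_of_iso
        (HomologicalComplex.singleObjXSelf (ComplexShape.up ℤ) 0 X).symm hX
    · exact C.prop_of_isTerminal _
        (HomologicalComplex.isZero_single_obj_X _ 0 X n hn).isTerminal
  have h' : KbOfInDbC C ((Qb C).obj ((toKb 𝒜).obj X)) :=
    ObjectProperty.prop_map_obj _ _ h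
  have hW : (KbOfInDbC C).trW (0 : 0 ⟶ (Qb C).obj ((toKb 𝒜).obj X)) :=
    ObjectProperty.trW.mk _ (contractible_distinguished₁ _) h'
  have := Localization.inverts (Qsg C) (KbOfInDbC C).trW _ hW
  exact IsZero.of_iso ((Qsg C).map_isZero (isZero_zero _))
    (asIso ((Qsg C).map (0 : 0 ⟶ (Qb C).obj ((toKb 𝒜).obj X)))).symm

end

/-! ### The Gorenstein category and its conflations -/

/-- The Gorenstein category `𝒢(C)`: the objects isomorphic to the image of `K⁻¹ ⟶ K⁰` for an
acyclic complex `K` of objects of `C` that is `Hom(C, -)`-exact and `Hom(-, C)`-exact. -/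
def gorenstein : ObjectProperty 𝒜 := fun M =>
  ∃ K : CochainComplex 𝒜 ℤ, (∀ n, C (K.X n)) ∧ K.Acyclic ∧ HomFromExact C K ∧ HomToExact C K ∧
    Nonempty (M ≅ image (K.d (-1) 0))

/-- The Gorenstein category as a category. -/
abbrev Gor := (gorenstein C).FullSubcategory

/-- The class `ε` of conflations of `𝒢(C)`: the complexes `0 ⟶ L ⟶ M ⟶ N ⟶ 0` with terms in
`𝒢(C)` such that `0 ⟶ Hom(X, L) ⟶ Hom(X, M) ⟶ Hom(X, N) ⟶ 0` is exact for all `X` in `C`. -/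
def IsConflation (S : ShortComplex (Gor C)) : Prop :=
  ∀ ⦃X : 𝒜⦄, C X →
    (S.map ((gorenstein C).ι ⋙ preadditiveCoyoneda.obj (op X))).ShortExact

/-- The complex `K` moved one step to the left, with unchanged differentials. -/
def moveLeft (K : CochainComplex 𝒜 ℤ) : CochainComplex 𝒜 ℤ where
  X n := K.X (n + 1)
  d i j := K.d (i + 1) (j + 1)
  shape i j h := K.shape _ _ (fun h' => h (by simp at h' ⊢; omega))

/-- A conflation `0 ⟶ M ⟶ I ⟶ M' ⟶ 0` with `I` in `C` and `M'` in `𝒢(C)`, such that every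
morphism from `M` to an object of `C` extends to `I`. -/
structure Cosyzygy (M : Gor C) where
  I : 𝒜
  cosyz : Gor C
  i : M.obj ⟶ I
  p : I ⟶ cosyz.obj
  prop_I : C I
  zero : i ≫ p = 0
  shortExact : (ShortComplex.mk i p zero).ShortExact
  lift ⦃X : 𝒜⦄ (_ : C X) (f : X ⟶ cosyz.obj) : ∃ g : X ⟶ I, g ≫ p = f
  extend ⦃X : 𝒜⦄ (_ : C X) (f : M.obj ⟶ X) : ∃ g : I ⟶ X, i ≫ g = f

instance (M : Gor C) : Nonempty (Cosyzygy C M) := by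
  obtain ⟨M, K, hK, hac, h₁, h₂, ⟨e⟩⟩ := M
  have hex (i j k : ℤ) (hij : i + 1 = j) (hjk : j + 1 = k) : (K.sc' i j k).Exact :=
    (HomologicalComplex.exactAt_iff' _ i j k (ComplexShape.prev_eq' _ hij)
      (ComplexShape.next_eq' _ hjk)).1 (hac j)
  have hG : gorenstein C (image (K.d 0 1)) := by
    refine ⟨moveLeft K, fun n => hK _, fun n => ?_, ?_, ?_, ⟨Iso.refl _⟩⟩
    · rw [HomologicalComplex.exactAt_iff' _ (n - 1) n (n + 1) (by simp) (by simp)]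
      exact hex (n - 1 + 1) (n + 1) (n + 1 + 1) (by omega) rfl
    · exact homFromExact_of_exists_lift fun X hX j f hf =>
        h₁.exists_lift hX (i := j - 1 + 1) (k := j + 1 + 1) (by omega) rfl f hf
    · exact homToExact_of_exists_desc fun X hX j f hf =>
        h₂.exists_desc hX (i := j - 1 + 1) (k := j + 1 + 1) (by omega) rfl f hf
  have hz : (e.hom ≫ image.ι (K.d (-1) 0)) ≫ factorThruImage (K.d 0 1) = 0 := by
    rw [← cancel_mono (image.ι (K.d 0 1)), ← cancel_epi e.inv,
      ← cancel_epi (factorThruImage (K.d (-1) 0))]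
    simp
  refine ⟨{ I := K.X 0, cosyz := ⟨_, hG⟩, i := e.hom ≫ image.ι (K.d (-1) 0)
            p := factorThruImage (K.d 0 1), prop_I := hK 0, zero := hz
            shortExact := ?_, lift := ?_, extend := ?_ }⟩
  · have : Mono (e.hom ≫ image.ι (K.d (-1) 0)) := inferInstance
    have : Epi (factorThruImage (K.d 0 1)) := inferInstance
    refine { exact := ?_, mono_f := ‹_›, epi_g := ‹_› }
    rw [ShortComplex.exact_iff_exact_up_to_refinements]
    intro A x hx
    have hx' : x ≫ K.d 0 1 = 0 := by
      have := congrArg (· ≫ image.ι (K.d 0 1)) hx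
      simpa using this
    obtain ⟨A', π, hπ, y, hy⟩ := (ShortComplex.exact_iff_exact_up_to_refinements _).1
      (hex (-1) 0 1 (by norm_num) (by norm_num)) x hx'
    refine ⟨A', π, hπ, y ≫ factorThruImage (K.d (-1) 0) ≫ e.inv, ?_⟩
    have hfac : (factorThruImage (K.d (-1) 0) ≫ e.inv) ≫ e.hom ≫ image.ι (K.d (-1) 0) =
        K.d (-1) 0 := by simp
    exact hy.trans ((congrArg (y ≫ ·) hfac.symm).trans (Category.assoc _ _ _).symm)
  · intro X hX f
    obtain ⟨g, hg⟩ := h₁.exists_lift hX (i := 0) (j := 1) (k := 2) (by norm_num) (by norm_num)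
      (f ≫ image.ι (K.d 0 1)) (by
        have : image.ι (K.d 0 1) ≫ K.d 1 2 = 0 := by
          rw [← cancel_epi (factorThruImage (K.d 0 1))]; simp
        rw [Category.assoc, this, comp_zero])
    exact ⟨g, by rw [← cancel_mono (image.ι (K.d 0 1))]; simpa using hg⟩
  · intro X hX f
    obtain ⟨g, hg⟩ := h₂.exists_desc hX (i := -2) (j := -1) (k := 0) (by norm_num) (by norm_num)
      (factorThruImage (K.d (-1) 0) ≫ e.inv ≫ f) (by
        have : K.d (-2) (-1) ≫ factorThruImage (K.d (-1) 0) = 0 := by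
          rw [← cancel_mono (image.ι (K.d (-1) 0))]; simp
        rw [reassoc_of% this, zero_comp])
    refine ⟨g, ?_⟩
    rw [← cancel_epi e.inv, ← cancel_epi (factorThruImage (K.d (-1) 0))]
    simpa using hg

/-- For each `M` in `𝒢(C)`, a chosen conflation `0 ⟶ M ⟶ I(M) ⟶ S(M) ⟶ 0`. -/
def cosyzygy (M : Gor C) : Cosyzygy C M := Classical.arbitrary _

/-! ### The stable category -/

/-- The morphism `f` of `𝒢(C)` factors through an object of `C`. -/
def FactorsThrough {M N : Gor C} (f : M ⟶ N) : Prop :=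
  ∃ (X : 𝒜) (_ : C X) (a : M.obj ⟶ X) (b : X ⟶ N.obj), a ≫ b = f.hom

/-- Two morphisms of `𝒢(C)` are identified in the stable category when their difference factors
through an object of `C`. -/
def stableRel : HomRel (Gor C) := fun _ _ f g => FactorsThrough C (f - g)

/-- The stable category of `𝒢(C)`. -/
abbrev Stable := CategoryTheory.Quotient (stableRel C)

/-- The projection functor to the stable category. -/
abbrev toStable : Gor C ⥤ Stable C := CategoryTheory.Quotient.functor (stableRel C)

variable {C} in
lemma FactorsThrough.add [C.IsClosedUnderFiniteProducts] {M N : Gor C} {f g : M ⟶ N} (hf : FactorsThrough C f)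
    (hg : FactorsThrough C g) : FactorsThrough C (f + g) := by
  obtain ⟨X, hX, a, b, h⟩ := hf
  obtain ⟨X', hX', a', b', h'⟩ := hg
  have := ObjectProperty.IsClosedUnderBinaryProducts.closedUnderIsomorphisms C
  refine ⟨X ⊞ X', C.prop_of_iso (biprod.isoProd _ _).symm (C.prop_prod _ _ hX hX'),
    biprod.lift a a', biprod.desc b b', ?_⟩
  rw [biprod.lift_desc, h, h']
  rfl

variable {C} in
lemma FactorsThrough.neg {M N : Gor C} {f : M ⟶ N} (hf : FactorsThrough C f) :
    FactorsThrough C (-f) := by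
  obtain ⟨X, hX, a, b, h⟩ := hf
  exact ⟨X, hX, -a, b, by rw [Preadditive.neg_comp, h]; rfl⟩

instance [C.IsClosedUnderFiniteProducts] : Congruence (stableRel C) where
  equivalence := {
    refl := fun f => by
      refine ⟨0, C.prop_of_isTerminal _ (isZero_zero 𝒜).isTerminal, 0, 0, ?_⟩
      rw [sub_self, comp_zero]
      rfl
    symm := fun {f g} h => by
      have := FactorsThrough.neg h
      rwa [neg_sub] at this
    trans := fun {f g k} h h' => by
      have := FactorsThrough.add h h'
      rwa [sub_add_sub_cancel] at this }
  comp_left := by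
    rintro M N P f g g' ⟨X, hX, a, b, h⟩
    refine ⟨X, hX, f.hom ≫ a, b, ?_⟩
    rw [Category.assoc, h, ← Preadditive.comp_sub]
    rfl
  comp_right := by
    rintro M N P f f' g ⟨X, hX, a, b, h⟩
    refine ⟨X, hX, a, b ≫ g.hom, ?_⟩
    rw [← Category.assoc, h, ← Preadditive.sub_comp]
    rfl

lemma stableRel_add [C.IsClosedUnderFiniteProducts] ⦃M N : Gor C⦄
    (f₁ f₂ g₁ g₂ : M ⟶ N) (hf : stableRel C f₁ f₂)
    (hg : stableRel C g₁ g₂) : stableRel C (f₁ + g₁) (f₂ + g₂) := by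
  have := FactorsThrough.add hf hg
  rwa [sub_add_sub_comm] at this

instance [C.IsClosedUnderFiniteProducts] : Preadditive (Stable C) :=
  CategoryTheory.Quotient.preadditive _ (stableRel_add C)

instance [C.IsClosedUnderFiniteProducts] : (toStable C).Additive :=
  CategoryTheory.Quotient.functor_additive _ (stableRel_add C)

/-! ### The suspension functor of the stable category -/

lemma exists_cosyzygyMap {M N : Gor C} (f : M ⟶ N) :
    ∃ (a : (cosyzygy C M).I ⟶ (cosyzygy C N).I)
      (b : (cosyzygy C M).cosyz ⟶ (cosyzygy C N).cosyz),
      (cosyzygy C M).i ≫ a = f.hom ≫ (cosyzygy C N).i ∧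
      (cosyzygy C M).p ≫ b.hom = a ≫ (cosyzygy C N).p := by
  obtain ⟨a, ha⟩ := (cosyzygy C M).extend (cosyzygy C N).prop_I (f.hom ≫ (cosyzygy C N).i)
  have hS := (cosyzygy C M).shortExact
  have := hS.epi_g
  have h0 : (cosyzygy C M).i ≫ a ≫ (cosyzygy C N).p = 0 := by
    rw [reassoc_of% ha, (cosyzygy C N).zero, comp_zero]
  exact ⟨a, ⟨hS.exact.desc _ h0⟩, ha, hS.exact.g_desc _ h0⟩

/-- The morphism `S(M) ⟶ S(N)` induced by an extension of `f` to a morphism `I(M) ⟶ I(N)`. -/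
def cosyzygyMap {M N : Gor C} (f : M ⟶ N) :
    (cosyzygy C M).cosyz ⟶ (cosyzygy C N).cosyz :=
  (exists_cosyzygyMap C f).choose_spec.choose

lemma cosyzygyMap_spec {M N : Gor C} (f : M ⟶ N) :
    ∃ a : (cosyzygy C M).I ⟶ (cosyzygy C N).I,
      (cosyzygy C M).i ≫ a = f.hom ≫ (cosyzygy C N).i ∧
      (cosyzygy C M).p ≫ (cosyzygyMap C f).hom = a ≫ (cosyzygy C N).p :=
  ⟨_, (exists_cosyzygyMap C f).choose_spec.choose_spec⟩

/-- A morphism of chosen conflations whose first component factors through `C` has a third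
component that factors through `C`. -/
lemma factorsThrough_cosyz {M N : Gor C} {f : M ⟶ N} (hf : FactorsThrough C f)
    (a : (cosyzygy C M).I ⟶ (cosyzygy C N).I)
    (b : (cosyzygy C M).cosyz ⟶ (cosyzygy C N).cosyz)
    (ha : (cosyzygy C M).i ≫ a = f.hom ≫ (cosyzygy C N).i)
    (hb : (cosyzygy C M).p ≫ b.hom = a ≫ (cosyzygy C N).p) : FactorsThrough C b := by
  obtain ⟨X, hX, x, y, hxy⟩ := hf
  obtain ⟨z, hz⟩ := (cosyzygy C M).extend hX x
  have hS := (cosyzygy C M).shortExact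
  have := hS.epi_g
  have h0 : (cosyzygy C M).i ≫ (a - z ≫ y ≫ (cosyzygy C N).i) = 0 := by
    rw [Preadditive.comp_sub, ha, reassoc_of% hz, reassoc_of% hxy, sub_self]
  refine ⟨_, (cosyzygy C N).prop_I, hS.exact.desc _ h0, (cosyzygy C N).p, ?_⟩
  rw [← cancel_epi (cosyzygy C M).p, hb]
  have h1 : (cosyzygy C M).p ≫ hS.exact.desc _ h0 = a - z ≫ y ≫ (cosyzygy C N).i :=
    hS.exact.g_desc _ h0
  rw [reassoc_of% h1, Preadditive.sub_comp, Category.assoc, Category.assoc,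
    (cosyzygy C N).zero, comp_zero, comp_zero, sub_zero]

lemma stableRel_cosyzygyMap {M N : Gor C} {f g : M ⟶ N} (h : stableRel C f g)
    (a : (cosyzygy C M).I ⟶ (cosyzygy C N).I)
    (b : (cosyzygy C M).cosyz ⟶ (cosyzygy C N).cosyz)
    (ha : (cosyzygy C M).i ≫ a = g.hom ≫ (cosyzygy C N).i)
    (hb : (cosyzygy C M).p ≫ b.hom = a ≫ (cosyzygy C N).p) :
    stableRel C (cosyzygyMap C f) b := by
  obtain ⟨a', ha', hb'⟩ := cosyzygyMap_spec C f
  refine factorsThrough_cosyz C h (a' - a) _ ?_ ?_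
  · rw [Preadditive.comp_sub, ha, ha', ← Preadditive.sub_comp]
    rfl
  · rw [Preadditive.sub_comp, ← hb, ← hb', ← Preadditive.comp_sub]
    rfl

lemma stableRel_refl [C.IsClosedUnderFiniteProducts] {M N : Gor C} (f : M ⟶ N) : stableRel C f f :=
  (Congruence.equivalence (r := stableRel C)).refl f

/-- The suspension functor of the stable category: it is `M ↦ S(M)` on objects. -/
def suspension [C.IsClosedUnderFiniteProducts] : Stable C ⥤ Stable C :=
  CategoryTheory.Quotient.lift (stableRel C)
    { obj := fun M => (toStable C).obj (cosyzygy C M).cosyz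
      map := fun f => (toStable C).map (cosyzygyMap C f)
      map_id := fun M => by
        rw [← (toStable C).map_id]
        exact CategoryTheory.Quotient.sound _ (stableRel_cosyzygyMap C (stableRel_refl C _)
          (𝟙 _) (𝟙 _) ((Category.comp_id _).trans (Category.id_comp _).symm)
          ((Category.comp_id _).trans (Category.id_comp _).symm))
      map_comp := fun {M N P} f g => by
        rw [← (toStable C).map_comp]
        obtain ⟨a, ha, hb⟩ := cosyzygyMap_spec C f
        obtain ⟨a', ha', hb'⟩ := cosyzygyMap_spec C g
        refine CategoryTheory.Quotient.sound _ (stableRel_cosyzygyMap C (stableRel_refl C _)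
          (a ≫ a') _ ?_ ?_)
        · rw [reassoc_of% ha, ha']
          exact (Category.assoc _ _ _).symm
        · rw [Category.assoc, ← hb', ← Category.assoc, ← hb, Category.assoc]
          rfl }
    (fun M N f g h => by
      obtain ⟨a, ha, hb⟩ := cosyzygyMap_spec C g
      exact CategoryTheory.Quotient.sound _ (stableRel_cosyzygyMap C h a _ ha hb))

section

variable [C.IsClosedUnderFiniteProducts]

/-! ### Distinguished triangles of the stable category -/

/-- The standard triangle `X ⟶ Y ⟶ Z ⟶ S(X)` of a morphism `u : X ⟶ Y` of `𝒢(C)`: here `Z` is the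
pushout of the chosen inflation `X ⟶ I(X)` along `u` (pushouts of inflations of `𝒢(C)` are computed
in `𝒜`), and `w` is induced by `I(X) ⟶ S(X)` and
`0 : Y ⟶ S(X)`. -/
def IsStandard {X Y Z : Gor C} (u : X ⟶ Y) (v : Y ⟶ Z) (w : Z ⟶ (cosyzygy C X).cosyz) : Prop :=
  ∃ t : (cosyzygy C X).I ⟶ Z.obj, IsPushout (cosyzygy C X).i u.hom t v.hom ∧
    t ≫ w.hom = (cosyzygy C X).p ∧ v ≫ w = 0

/-- The distinguished triangles of the stable category: the sextuples isomorphic to the image of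
a standard triangle. -/
def IsDistinguished {X Y Z : Stable C} (u : X ⟶ Y) (v : Y ⟶ Z) (w : Z ⟶ (suspension C).obj X) :
    Prop :=
  ∃ (X' Y' Z' : Gor C) (u' : X' ⟶ Y') (v' : Y' ⟶ Z') (w' : Z' ⟶ (cosyzygy C X').cosyz)
    (_ : IsStandard C u' v' w')
    (a : X ≅ (toStable C).obj X') (b : Y ≅ (toStable C).obj Y') (c : Z ≅ (toStable C).obj Z'),
    u ≫ b.hom = a.hom ≫ (toStable C).map u' ∧
    v ≫ c.hom = b.hom ≫ (toStable C).map v' ∧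
    w ≫ (suspension C).map a.hom = c.hom ≫ (toStable C).map w'

/-! ### The functors to the `C`-singularity category -/

/-- The functor `θ : 𝒢(C) ⥤ D_{C-sg}(𝒜)`. -/
def theta : Gor C ⥤ Dsg C := (gorenstein C).ι ⋙ toDsg C

/-- The functor `θ'` induced by `θ` on the stable category. -/
def thetaStable : Stable C ⥤ Dsg C :=
  CategoryTheory.Quotient.lift (stableRel C) (theta C) (fun M N f g h => by
    obtain ⟨X, hX, a, b, hab⟩ := h
    have h1 : (toDsg C).map (f.hom - g.hom) = 0 := by
      have h2 : f.hom - g.hom = a ≫ b := hab.symm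
      rw [h2, Functor.map_comp, (isZero_toDsg C hX).eq_of_src ((toDsg C).map b) 0, comp_zero]
    rw [Functor.map_sub, sub_eq_zero] at h1
    exact h1)

variable {T : Type*} [Category T] [HasZeroObject T] [HasShift T ℤ] [Preadditive T]
  [∀ n : ℤ, (shiftFunctor T n).Additive] [Pretriangulated T]

/-- `F : 𝒢(C) ⥤ T` is a `∂`-functor: it is additive and there are connecting morphisms
`ω_S : F(N) ⟶ F(L)[1]`, for all conflations `S : L ⟶ M ⟶ N`, which are functorial in `S` and turn
the image of `S` into a distinguished triangle. -/
def IsDeltaFunctor (F : Gor C ⥤ T) : Prop :=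
  F.Additive ∧
  ∃ ω : ∀ S : ShortComplex (Gor C), IsConflation C S → (F.obj S.X₃ ⟶ (F.obj S.X₁)⟦(1 : ℤ)⟧),
    (∀ (S : ShortComplex (Gor C)) (hS : IsConflation C S),
      Triangle.mk (F.map S.f) (F.map S.g) (ω S hS) ∈ distTriang T) ∧
    ∀ (S S' : ShortComplex (Gor C)) (hS : IsConflation C S) (hS' : IsConflation C S')
      (φ : S ⟶ S'), ω S hS ≫ (F.map φ.τ₁)⟦(1 : ℤ)⟧' = F.map φ.τ₃ ≫ ω S' hS'

/-- `F` is a triangle functor from the stable category of `𝒢(C)` to `T`: it is additive and there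
is a natural isomorphism `F ∘ S ≅ [1] ∘ F` through which `F` sends distinguished triangles to
distinguished triangles. -/
def IsTriangleFunctor (F : Stable C ⥤ T) : Prop :=
  F.Additive ∧
  ∃ ω : suspension C ⋙ F ≅ F ⋙ shiftFunctor T (1 : ℤ),
    ∀ ⦃X Y Z : Stable C⦄ (u : X ⟶ Y) (v : Y ⟶ Z) (w : Z ⟶ (suspension C).obj X),
      IsDistinguished C u v w →
        Triangle.mk (F.map u) (F.map v) (F.map w ≫ ω.hom.app X) ∈ distTriang T

end

end RelSing

end

/-!
For a `Hom(C, -)`-exact sequence `0 ⟶ L ⟶ M ⟶ N ⟶ 0`, the comparison morphism from the mapping cone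
of `L ⟶ M` to `N` becomes a quasi-isomorphism under `Hom(X, -)` for all `X` in `C`, hence invertible
in `D^b_C(𝒜)`; composing its inverse with the boundary of the cone gives `ω : N ⟶ L[1]`. Cones are
not functorial, but there are no nonzero morphisms `L[1] ⟶ N'` in `K^b(𝒜)` between objects of `𝒜`,
so every morphism of cones is compatible with the comparison morphisms, and `ω` is natural.

Conversely, let a functor on the stable category restrict to a `∂`-functor on `𝒢(C)`. It kills the
middle term of `0 ⟶ X ⟶ I(X) ⟶ S(X) ⟶ 0`, so `ω` is invertible there. For the pushout `Z` of
`X ⟶ I(X)` along `u : X ⟶ Y`, the sequence `0 ⟶ Y ⟶ Z ⟶ S(X) ⟶ 0` is again a conflation, whose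
connecting morphism is, by naturality, that of `X` followed by `u[1]`; rotating its triangle back
gives the image of the standard triangle of `u`.
-/

noncomputable section

namespace RelSing

lemma distinguished_of_iso₃ {T : Type*} [Category T] [Preadditive T] [HasZeroObject T]
    [HasShift T ℤ] [∀ n : ℤ, (shiftFunctor T n).Additive] [Pretriangulated T]
    {X Y Z Z' : T} {f : X ⟶ Y} {g : Y ⟶ Z} {h : Z ⟶ X⟦(1 : ℤ)⟧}
    (hT : Triangle.mk f g h ∈ distTriang T) (e : Z ≅ Z') {g' : Y ⟶ Z'} {h' : Z' ⟶ X⟦(1 : ℤ)⟧}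
    (hg : g ≫ e.hom = g') (hh : e.hom ≫ h' = h) : Triangle.mk f g' h' ∈ distTriang T :=
  have shift_id : h ≫ (𝟙 X)⟦(1 : ℤ)⟧' = e.hom ≫ h' := by simp [hh]
  isomorphic_distinguished _ hT _ <| Iso.symm <| Triangle.isoMk (.mk f g h) (.mk f g' h')
    (Iso.refl X) (Iso.refl Y) e ((Category.comp_id f).trans (Category.id_comp f).symm)
    (hg.trans (Category.id_comp g').symm) shift_id

section ConnectingRoof

variable {𝒜 𝒦 𝒯 : Type*} [Category 𝒜] [HasZeroMorphisms 𝒜]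
  [Category 𝒦] [Preadditive 𝒦] [HasZeroObject 𝒦] [HasShift 𝒦 ℤ]
  [∀ n : ℤ, (shiftFunctor 𝒦 n).Additive] [Pretriangulated 𝒦]
  [Category 𝒯]

/-- A roof `J(S₃) ⟵ cone ⟶ J(S₁)[1]` over a short complex `S`, formed by a comparison morphism
`desc` from a cone of `J(S₁) ⟶ J(S₂)` to `J(S₃)` that becomes invertible under `F`. It represents
the connecting morphism of `S` along `J ⋙ F`. -/
structure ConnectingRoof (J : 𝒜 ⥤ 𝒦) (F : 𝒦 ⥤ 𝒯) (S : ShortComplex 𝒜) where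
  cone : 𝒦
  inr : J.obj S.X₂ ⟶ cone
  boundary : cone ⟶ (J.obj S.X₁)⟦(1 : ℤ)⟧
  desc : cone ⟶ J.obj S.X₃
  distinguished : Triangle.mk (J.map S.f) inr boundary ∈ distTriang 𝒦
  inr_desc : inr ≫ desc = J.map S.g
  isIso_map_desc : IsIso (F.map desc)

namespace ConnectingRoof

attribute [instance] isIso_map_desc

variable {J : 𝒜 ⥤ 𝒦} {F : 𝒦 ⥤ 𝒯} {S S' : ShortComplex 𝒜}

lemma exists_cone_map (R : ConnectingRoof J F S) (R' : ConnectingRoof J F S') (φ : S ⟶ S')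
    (hJ : ∀ f : (J.obj S.X₁)⟦(1 : ℤ)⟧ ⟶ J.obj S'.X₃, f = 0) :
    ∃ c : R.cone ⟶ R'.cone, R.boundary ≫ (J.map φ.τ₁)⟦(1 : ℤ)⟧' = c ≫ R'.boundary ∧
      c ≫ R'.desc = R.desc ≫ J.map φ.τ₃ := by
  have comm : J.map S.f ≫ J.map φ.τ₂ = J.map φ.τ₁ ≫ J.map S'.f := by
    rw [← J.map_comp, ← J.map_comp, φ.comm₁₂]
  obtain ⟨c, hinr, hboundary⟩ : ∃ c : R.cone ⟶ R'.cone, R.inr ≫ c = J.map φ.τ₂ ≫ R'.inr ∧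
      R.boundary ≫ (J.map φ.τ₁)⟦(1 : ℤ)⟧' = c ≫ R'.boundary :=
    complete_distinguished_triangle_morphism _ _ R.distinguished R'.distinguished _ _ comm
  refine ⟨c, hboundary, ?_⟩
  have hzero : R.inr ≫ (c ≫ R'.desc - R.desc ≫ J.map φ.τ₃) = 0 := by
    rw [Preadditive.comp_sub, reassoc_of% hinr, R'.inr_desc, reassoc_of% R.inr_desc,
      ← J.map_comp, ← J.map_comp, φ.comm₂₃, sub_self]
  obtain ⟨e, he⟩ : ∃ e, c ≫ R'.desc - R.desc ≫ J.map φ.τ₃ = R.boundary ≫ e :=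
    Triangle.yoneda_exact₃ _ R.distinguished _ hzero
  rw [hJ e, comp_zero] at he
  exact sub_eq_zero.1 he

variable [HasShift 𝒯 ℤ] [F.CommShift ℤ]

/-- The connecting morphism represented by a roof. -/
def connecting (R : ConnectingRoof J F S) :
    (J ⋙ F).obj S.X₃ ⟶ ((J ⋙ F).obj S.X₁)⟦(1 : ℤ)⟧ :=
  inv (F.map R.desc) ≫ F.map R.boundary ≫ (F.commShiftIso (1 : ℤ)).hom.app (J.obj S.X₁)

lemma connecting_naturality (R : ConnectingRoof J F S) (R' : ConnectingRoof J F S') (φ : S ⟶ S')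
    (hJ : ∀ f : (J.obj S.X₁)⟦(1 : ℤ)⟧ ⟶ J.obj S'.X₃, f = 0) :
    R.connecting ≫ ((J ⋙ F).map φ.τ₁)⟦(1 : ℤ)⟧' = (J ⋙ F).map φ.τ₃ ≫ R'.connecting := by
  obtain ⟨c, hboundary, hdesc⟩ := R.exists_cone_map R' φ hJ
  simp only [connecting, Category.assoc, Functor.comp_map, IsIso.inv_comp_eq]
  rw [← F.commShiftIso_hom_naturality, ← F.map_comp_assoc, hboundary, ← F.map_comp_assoc R.desc,
    ← hdesc]
  simp only [Functor.map_comp, Category.assoc, IsIso.hom_inv_id_assoc]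

variable [Preadditive 𝒯] [HasZeroObject 𝒯] [∀ n : ℤ, (shiftFunctor 𝒯 n).Additive]
  [Pretriangulated 𝒯] [F.IsTriangulated]

lemma connecting_distinguished (R : ConnectingRoof J F S) :
    Triangle.mk ((J ⋙ F).map S.f) ((J ⋙ F).map S.g) R.connecting ∈ distTriang 𝒯 := by
  let e : F.obj R.cone ≅ F.obj (J.obj S.X₃) := asIso (F.map R.desc)
  exact distinguished_of_iso₃ (F.map_distinguished _ R.distinguished) e
    ((F.map_comp _ _).symm.trans (F.congr_map R.inr_desc)) (e.hom_inv_id_assoc _)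

end ConnectingRoof

end ConnectingRoof

lemma homotopyCategory_hom_eq_zero {𝒜 ι : Type*} [Category 𝒜] [Preadditive 𝒜] {c : ComplexShape ι}
    {K L : HomotopyCategory 𝒜 c} (h : ∀ n, IsZero (K.as.X n) ∨ IsZero (L.as.X n)) (f : K ⟶ L) :
    f = 0 := by
  obtain ⟨g : K.as ⟶ L.as, rfl⟩ := (HomotopyCategory.quotient 𝒜 c).map_surjective f
  have hg : g = 0 := by
    ext n
    exact (h n).elim (fun hK => hK.eq_of_src _ _) (fun hL => hL.eq_of_tgt _ _)
  rw [hg]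
  exact (HomotopyCategory.quotient 𝒜 c).map_zero _ _

variable {𝒜 : Type u} [Category.{v} 𝒜] [Abelian 𝒜]

lemma shift_toKb_hom_eq_zero {X Y : 𝒜} (f : ((toKb 𝒜).obj X)⟦(1 : ℤ)⟧ ⟶ (toKb 𝒜).obj Y) :
    f = 0 := by
  have shift_single := HomotopyCategory.shift_quotient_obj
    ((CochainComplex.singleFunctor 𝒜 0).obj X) 1
  have h (g : ((HomotopyCategory.singleFunctor 𝒜 0).obj X)⟦(1 : ℤ)⟧ ⟶
      (HomotopyCategory.singleFunctor 𝒜 0).obj Y) : g = 0 := by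
    refine homotopyCategory_hom_eq_zero (fun n => ?_) g
    by_cases hn : n = 0
    · exact .inl (shift_single.symm ▸
        HomologicalComplex.isZero_single_obj_X (.up ℤ) 0 X (n + 1) (by omega))
    · exact .inr (HomologicalComplex.isZero_single_obj_X (.up ℤ) 0 Y n hn)
  apply (bounded 𝒜).ι.map_injective
  rw [← cancel_epi (((bounded 𝒜).ι.commShiftIso (1 : ℤ)).inv.app _), Functor.map_zero, comp_zero]
  exact h _

section

variable {ℬ : Type*} [Category ℬ] [Abelian ℬ] (F : 𝒜 ⥤ ℬ) [F.Additive]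

lemma quasiIso_map_descShortComplex {S : ShortComplex (CochainComplex 𝒜 ℤ)}
    (hS : (S.map (F.mapHomologicalComplex (.up ℤ))).ShortExact) :
    QuasiIso ((F.mapHomologicalComplex (.up ℤ)).map
      (CochainComplex.mappingCone.descShortComplex S)) := by
  let e := CochainComplex.mappingCone.mapHomologicalComplexIso S.f F
  have he : HomologicalComplex.quasiIso ℬ (.up ℤ) e.hom := quasiIso_of_isIso e.hom
  rw [← CochainComplex.mappingCone.mapHomologicalComplexIso_hom_descShortComplex]
  exact MorphismProperty.comp_mem _ _ _ he
    (CochainComplex.mappingCone.quasiIso_descShortComplex hS)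

lemma shortExact_map_single {S : ShortComplex 𝒜} (hS : (S.map F).ShortExact) :
    ((S.map (CochainComplex.singleFunctor 𝒜 0)).map
      (F.mapHomologicalComplex (.up ℤ))).ShortExact :=
  ShortComplex.shortExact_of_iso
    (S.mapNatIso (HomologicalComplex.singleMapHomologicalComplex F (.up ℤ) 0).symm)
    (hS.map_of_exact (HomologicalComplex.single ℬ (.up ℤ) 0))

end

variable (C : ObjectProperty 𝒜)

lemma trW_acyclic_iff {K L : Kb 𝒜} (f : K ⟶ L) :
    (acyclic C).trW f ↔ ∀ ⦃X : 𝒜⦄, C X → HomotopyCategory.quasiIso AddCommGrpCat.{v} (.up ℤ)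
      (((preadditiveCoyoneda.obj (op X)).mapHomotopyCategory (.up ℤ)).map f.hom) := by
  obtain ⟨Z, g, h, hT⟩ := distinguished_cocone_triangle f
  refine ((acyclic C).trW_iff_of_distinguished _ hT).trans ((acyclic_iff C Z).trans ?_)
  refine forall_congr' fun X => forall_congr' fun _ => ?_
  rw [HomotopyCategory.quasiIso_eq_trW_subcategoryAcyclic]
  exact (ObjectProperty.trW_iff_of_distinguished _ _ hT).symm.trans
    (ObjectProperty.inverseImage_trW_iff ..)

/-- A short complex `S` is `Hom(C, -)`-exact if `0 ⟶ Hom(X, S.X₁) ⟶ Hom(X, S.X₂) ⟶ Hom(X, S.X₃) ⟶ 0`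
is exact for all `X` in `C`. -/
def HomFromShortExact (S : ShortComplex 𝒜) : Prop :=
  ∀ ⦃X : 𝒜⦄, C X → (S.map (preadditiveCoyoneda.obj (op X))).ShortExact

lemma exists_iso_mappingCone_single {X Y : 𝒜} {f : X ⟶ Y} {K : Kb 𝒜} {inr : (toKb 𝒜).obj Y ⟶ K}
    {boundary : K ⟶ ((toKb 𝒜).obj X)⟦(1 : ℤ)⟧}
    (hT : Triangle.mk ((toKb 𝒜).map f) inr boundary ∈ distTriang (Kb 𝒜)) :
    ∃ e : K.obj ≅ (HomotopyCategory.quotient 𝒜 (.up ℤ)).obj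
        (CochainComplex.mappingCone ((CochainComplex.singleFunctor 𝒜 0).map f)),
      inr.hom ≫ e.hom = (HomotopyCategory.quotient 𝒜 (.up ℤ)).map
        (CochainComplex.mappingCone.inr ((CochainComplex.singleFunctor 𝒜 0).map f)) := by
  let e := isoTriangleOfIso₁₂ _ _ ((bounded 𝒜).ι.map_distinguished _ hT)
    (HomotopyCategory.mappingCone_triangleh_distinguished
      ((CochainComplex.singleFunctor 𝒜 0).map f)) (Iso.refl _) (Iso.refl _)
    ((Category.comp_id _).trans (Category.id_comp _).symm)
  exact ⟨Triangle.π₃.mapIso e, e.hom.comm₂.trans (Category.id_comp _)⟩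

variable {C} in
lemma exists_desc_trW_acyclic {S : ShortComplex 𝒜} (hS : HomFromShortExact C S) {K : Kb 𝒜}
    {inr : (toKb 𝒜).obj S.X₂ ⟶ K} {boundary : K ⟶ ((toKb 𝒜).obj S.X₁)⟦(1 : ℤ)⟧}
    (hT : Triangle.mk ((toKb 𝒜).map S.f) inr boundary ∈ distTriang (Kb 𝒜)) :
    ∃ desc : K ⟶ (toKb 𝒜).obj S.X₃,
      inr ≫ desc = (toKb 𝒜).map S.g ∧ (acyclic C).trW desc := by
  let S' := S.map (CochainComplex.singleFunctor 𝒜 0)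
  let π : (HomotopyCategory.quotient 𝒜 (.up ℤ)).obj (CochainComplex.mappingCone S'.f) ⟶
      ((toKb 𝒜).obj S.X₃).obj :=
    (HomotopyCategory.quotient _ _).map (CochainComplex.mappingCone.descShortComplex S')
  have inr_π : (HomotopyCategory.quotient 𝒜 (.up ℤ)).map (CochainComplex.mappingCone.inr S'.f) ≫
      π = ((toKb 𝒜).map S.g).hom :=
    ((HomotopyCategory.quotient _ _).map_comp _ _).symm.trans
      (congrArg _ (CochainComplex.mappingCone.inr_descShortComplex S'))
  obtain ⟨e, inr_e⟩ := exists_iso_mappingCone_single hT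
  refine ⟨(bounded 𝒜).homMk (e.hom ≫ π), ObjectProperty.hom_ext _ ?_, ?_⟩
  · exact (Category.assoc _ _ _).symm.trans ((congrArg (· ≫ π) inr_e).trans inr_π)
  · rw [trW_acyclic_iff]
    intro X hX
    let F := preadditiveCoyoneda.obj (op X)
    have hπ : HomotopyCategory.quasiIso _ (.up ℤ) ((F.mapHomotopyCategory (.up ℤ)).map π) :=
      (HomotopyCategory.quotient_map_mem_quasiIso_iff _).2
        (quasiIso_map_descShortComplex F (shortExact_map_single F (hS hX)))
    exact (((HomotopyCategory.quasiIso _ _).inverseImage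
      (F.mapHomotopyCategory _)).cancel_left_of_respectsIso e.hom π).2 hπ

variable {C} in
lemma nonempty_connectingRoof_toKb {S : ShortComplex 𝒜} (hS : HomFromShortExact C S) :
    Nonempty (ConnectingRoof (toKb 𝒜) (Qb C ⋙ Qsg C) S) := by
  obtain ⟨K, inr, boundary, hT⟩ := distinguished_cocone_triangle ((toKb 𝒜).map S.f)
  obtain ⟨desc, inr_desc, hdesc⟩ := exists_desc_trW_acyclic hS hT
  have : IsIso ((Qb C).map desc) := Localization.inverts (Qb C) (acyclic C).trW desc hdesc
  exact ⟨⟨K, inr, boundary, desc, hT, inr_desc, inferInstanceAs (IsIso ((Qsg C).map _))⟩⟩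

instance [C.IsClosedUnderFiniteProducts] : (theta C).Additive := by
  unfold theta
  infer_instance

theorem isDeltaFunctor_theta [C.IsClosedUnderFiniteProducts] : IsDeltaFunctor C (theta C) := by
  have hroof (S : ShortComplex (Gor C)) (hS : IsConflation C S) :
      Nonempty (ConnectingRoof (toKb 𝒜) (Qb C ⋙ Qsg C) (S.map (gorenstein C).ι)) :=
    nonempty_connectingRoof_toKb hS
  exact ⟨inferInstance, fun S hS => (hroof S hS).some.connecting,
    fun S hS => (hroof S hS).some.connecting_distinguished,
    fun S S' hS hS' φ => (hroof S hS).some.connecting_naturality (hroof S' hS').some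
      ((gorenstein C).ι.mapShortComplex.map φ) shift_toKb_hom_eq_zero⟩

variable {C} in
lemma homFromShortExact_of_exists_lift {S : ShortComplex 𝒜} (hS : S.ShortExact)
    (h : ∀ ⦃X : 𝒜⦄, C X → ∀ f : X ⟶ S.X₃, ∃ g : X ⟶ S.X₂, g ≫ S.g = f) :
    HomFromShortExact C S := fun X hX =>
  have := hS.mono_f
  { exact := (ShortComplex.ab_exact_iff _).2 fun (f : X ⟶ S.X₂) hf =>
      ⟨hS.exact.lift f hf, hS.exact.lift_f f hf⟩
    mono_f := (AddCommGrpCat.mono_iff_injective _).2 fun (_ _ : X ⟶ S.X₁) hfg =>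
      (cancel_mono S.f).1 hfg
    epi_g := (AddCommGrpCat.epi_iff_surjective _).2 fun f => h hX f }

lemma shortExact_of_isPushout {S : ShortComplex 𝒜} (hS : S.ShortExact) {Y Z : 𝒜} {u : S.X₁ ⟶ Y}
    {t : S.X₂ ⟶ Z} {v : Y ⟶ Z} (sq : IsPushout S.f u t v) {w : Z ⟶ S.X₃} (htw : t ≫ w = S.g)
    (hvw : v ≫ w = 0) : (ShortComplex.mk v w hvw).ShortExact := by
  have := hS.mono_f
  have := hS.epi_g
  have hv : Mono v := (MorphismProperty.monomorphisms 𝒜).of_isPushout sq.flip ‹_›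
  have hw : Epi w := epi_of_epi_fac htw
  refine { exact := ShortComplex.exact_of_g_is_cokernel _ (CokernelCofork.IsColimit.ofπ' w hvw ?_) }
  intro A k hk
  have h₀ : S.f ≫ t ≫ k = 0 := by rw [sq.w_assoc, hk, comp_zero]
  refine ⟨hS.exact.desc _ h₀, sq.hom_ext ?_ ?_⟩
  · rw [reassoc_of% htw]
    exact hS.exact.g_desc _ h₀
  · rw [reassoc_of% hvw, zero_comp, hk]

variable {C} in
lemma IsStandard.isConflation {X Y Z : Gor C} {u : X ⟶ Y} {v : Y ⟶ Z}
    {w : Z ⟶ (cosyzygy C X).cosyz} (h : IsStandard C u v w) (hvw : v ≫ w = 0) :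
    IsConflation C (ShortComplex.mk v w hvw) := by
  obtain ⟨t, sq, htw, -⟩ := h
  refine homFromShortExact_of_exists_lift (shortExact_of_isPushout (cosyzygy C X).shortExact sq htw
    (congrArg (·.hom) hvw)) fun A hA f => ?_
  obtain ⟨g, hg⟩ := (cosyzygy C X).lift hA f
  exact ⟨g ≫ t, (Category.assoc _ _ _).trans ((congrArg (g ≫ ·) htw).trans hg)⟩

namespace IsDeltaFunctor

variable {C} {T : Type*} [Category T] [HasZeroObject T] [HasShift T ℤ] [Preadditive T]
  [∀ n : ℤ, (shiftFunctor T n).Additive] [Pretriangulated T]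
  {G : Gor C ⥤ T} (hG : IsDeltaFunctor C G)

/-- The connecting morphism of a conflation under a `∂`-functor. -/
def connecting {S : ShortComplex (Gor C)} (hS : IsConflation C S) :
    G.obj S.X₃ ⟶ (G.obj S.X₁)⟦(1 : ℤ)⟧ :=
  hG.2.choose S hS

lemma connecting_distinguished {S : ShortComplex (Gor C)} (hS : IsConflation C S) :
    Triangle.mk (G.map S.f) (G.map S.g) (hG.connecting hS) ∈ distTriang T :=
  hG.2.choose_spec.1 S hS

lemma connecting_naturality {S S' : ShortComplex (Gor C)} (hS : IsConflation C S)
    (hS' : IsConflation C S') (φ : S ⟶ S') :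
    hG.connecting hS ≫ (G.map φ.τ₁)⟦(1 : ℤ)⟧' = G.map φ.τ₃ ≫ hG.connecting hS' :=
  hG.2.choose_spec.2 S S' hS hS' φ

lemma isIso_connecting {S : ShortComplex (Gor C)} (hS : IsConflation C S)
    (hX₂ : IsZero (G.obj S.X₂)) : IsIso (hG.connecting hS) :=
  (Triangle.isZero₂_iff_isIso₃ _ (hG.connecting_distinguished hS)).1 hX₂

end IsDeltaFunctor

/-- `K` is contractible in each degree separately: the identity of each term is of the form
`s ≫ d + d ≫ t`. -/
def IsDegreewiseContractible (K : CochainComplex 𝒜 ℤ) : Prop :=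
  ∀ ⦃i j k : ℤ⦄, i + 1 = j → j + 1 = k →
    ∃ (s : K.X j ⟶ K.X i) (t : K.X k ⟶ K.X j), s ≫ K.d i j + K.d j k ≫ t = 𝟙 (K.X j)

namespace IsDegreewiseContractible

variable {K : CochainComplex 𝒜 ℤ} (hK : IsDegreewiseContractible K)
include hK

lemma exists_lift {i j k : ℤ} (hij : i + 1 = j) (hjk : j + 1 = k) {X : 𝒜} (f : X ⟶ K.X j)
    (hf : f ≫ K.d j k = 0) : ∃ g : X ⟶ K.X i, g ≫ K.d i j = f := by
  obtain ⟨s, t, hst⟩ := hK hij hjk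
  refine ⟨f ≫ s, ?_⟩
  calc (f ≫ s) ≫ K.d i j = f ≫ (s ≫ K.d i j + K.d j k ≫ t) := by
        rw [Preadditive.comp_add, reassoc_of% hf, zero_comp, add_zero, Category.assoc]
    _ = f := by rw [hst, Category.comp_id]

lemma exists_desc {i j k : ℤ} (hij : i + 1 = j) (hjk : j + 1 = k) {X : 𝒜} (f : K.X j ⟶ X)
    (hf : K.d i j ≫ f = 0) : ∃ g : K.X k ⟶ X, K.d j k ≫ g = f := by
  obtain ⟨s, t, hst⟩ := hK hij hjk
  refine ⟨t ≫ f, ?_⟩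
  calc K.d j k ≫ t ≫ f = (s ≫ K.d i j + K.d j k ≫ t) ≫ f := by
        rw [Preadditive.add_comp, Category.assoc, hf, comp_zero, zero_add, Category.assoc]
    _ = f := by rw [hst, Category.id_comp]

lemma acyclic : K.Acyclic := fun j => by
  rw [HomologicalComplex.exactAt_iff' _ (j - 1) j (j + 1) (by simp) (by simp),
    ShortComplex.exact_iff_exact_up_to_refinements]
  intro A x hx
  obtain ⟨y, hy⟩ := hK.exists_lift (i := j - 1) (k := j + 1) (by omega) rfl x hx
  exact ⟨A, 𝟙 A, inferInstance, y, (Category.id_comp x).trans hy.symm⟩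

lemma homFromExact : HomFromExact C K :=
  homFromExact_of_exists_lift fun _ _ _ f hf => hK.exists_lift (by omega) rfl f hf

lemma homToExact : HomToExact C K :=
  homToExact_of_exists_desc fun _ _ _ f hf => hK.exists_desc (by omega) rfl f hf

end IsDegreewiseContractible

/-- The complex `X ⟶ X` given by the identity, in degrees `-1` and `0`. -/
abbrev identityComplex (X : 𝒜) : CochainComplex 𝒜 ℤ :=
  HomologicalComplex.double (𝟙 X) (show (ComplexShape.up ℤ).Rel (-1) 0 from rfl)

instance (X : 𝒜) : IsIso ((identityComplex X).d (-1) 0) := by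
  rw [HomologicalComplex.double_d _ _ (by decide)]
  infer_instance

lemma isDegreewiseContractible_identityComplex (X : 𝒜) :
    IsDegreewiseContractible (identityComplex X) := by
  intro i j k hij hjk
  by_cases h₀ : j = 0
  · obtain ⟨rfl, rfl⟩ : i = -1 ∧ j = 0 := by omega
    refine ⟨inv ((identityComplex X).d (-1) 0), 0, ?_⟩
    rw [IsIso.inv_hom_id, comp_zero, add_zero]
  by_cases h₁ : j = -1
  · obtain ⟨rfl, rfl⟩ : j = -1 ∧ k = 0 := by omega
    refine ⟨0, inv ((identityComplex X).d (-1) 0), ?_⟩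
    rw [IsIso.hom_inv_id, zero_comp, zero_add]
  · exact ⟨0, 0, (HomologicalComplex.isZero_double_X _ _ j h₁ h₀).eq_of_src _ _⟩

variable [C.IsClosedUnderFiniteProducts]

lemma prop_identityComplex {X : 𝒜} (hX : C X) (n : ℤ) : C ((identityComplex X).X n) := by
  have := ObjectProperty.IsClosedUnderBinaryProducts.closedUnderIsomorphisms C
  by_cases h₀ : n = 0
  · subst h₀
    exact C.prop_of_iso (HomologicalComplex.doubleXIso₁ _ _ (by decide)).symm hX
  by_cases h₁ : n = -1
  · subst h₁
    exact C.prop_of_iso (HomologicalComplex.doubleXIso₀ _ _).symm hX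
  · exact C.prop_of_isTerminal _ (HomologicalComplex.isZero_double_X _ _ n h₁ h₀).isTerminal

lemma le_gorenstein : C ≤ gorenstein C := fun X hX =>
  have hK := isDegreewiseContractible_identityComplex X
  have : IsIso (image.ι ((identityComplex X).d (-1) 0)) :=
    have := epi_image_of_epi ((identityComplex X).d (-1) 0)
    isIso_of_mono_of_epi _
  ⟨identityComplex X, prop_identityComplex C hX, hK.acyclic, hK.homFromExact C, hK.homToExact C,
    ⟨(HomologicalComplex.doubleXIso₁ (𝟙 X) _ (by decide)).symm ≪≫
      (asIso (image.ι ((identityComplex X).d (-1) 0))).symm⟩⟩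

variable {C} in
lemma isZero_toStable {M : Gor C} (hM : C M.obj) : IsZero ((toStable C).obj M) := by
  have h : stableRel C (𝟙 M) 0 := ⟨M.obj, hM, 𝟙 _, 𝟙 _, by rw [sub_zero]; exact Category.comp_id _⟩
  rw [IsZero.iff_id_eq_zero, ← (toStable C).map_id, ← (toStable C).map_zero M M]
  exact CategoryTheory.Quotient.sound _ h

/-- The chosen conflation `0 ⟶ M ⟶ I(M) ⟶ S(M) ⟶ 0`, as a short complex in `𝒢(C)`. -/
abbrev cosyzygySequence (M : Gor C) : ShortComplex (Gor C) where
  X₁ := M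
  X₂ := ⟨(cosyzygy C M).I, le_gorenstein C _ (cosyzygy C M).prop_I⟩
  X₃ := (cosyzygy C M).cosyz
  f := (gorenstein C).homMk (cosyzygy C M).i
  g := (gorenstein C).homMk (cosyzygy C M).p
  zero := ObjectProperty.hom_ext _ (cosyzygy C M).zero

lemma isConflation_cosyzygySequence (M : Gor C) : IsConflation C (cosyzygySequence C M) :=
  homFromShortExact_of_exists_lift (cosyzygy C M).shortExact (cosyzygy C M).lift

lemma exists_cosyzygySequence_hom {M N : Gor C} (f : M ⟶ N) :
    ∃ φ : cosyzygySequence C M ⟶ cosyzygySequence C N, φ.τ₁ = f ∧ φ.τ₃ = cosyzygyMap C f := by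
  obtain ⟨a, ha, hb⟩ := cosyzygyMap_spec C f
  exact ⟨{
    τ₁ := f
    τ₂ := (gorenstein C).homMk a
    τ₃ := cosyzygyMap C f
    comm₁₂ := ObjectProperty.hom_ext _ ha.symm
    comm₂₃ := ObjectProperty.hom_ext _ hb.symm }, rfl, rfl⟩

variable {C} in
lemma IsStandard.exists_cosyzygySequence_hom {X Y Z : Gor C} {u : X ⟶ Y} {v : Y ⟶ Z}
    {w : Z ⟶ (cosyzygy C X).cosyz} (h : IsStandard C u v w) (hvw : v ≫ w = 0) :
    ∃ φ : cosyzygySequence C X ⟶ ShortComplex.mk v w hvw, φ.τ₁ = u ∧ φ.τ₃ = 𝟙 _ := by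
  obtain ⟨t, sq, htw, -⟩ := h
  exact ⟨{
    τ₁ := u
    τ₂ := (gorenstein C).homMk t
    τ₃ := 𝟙 _
    comm₁₂ := ObjectProperty.hom_ext _ sq.w.symm
    comm₂₃ := ObjectProperty.hom_ext _ (htw.trans (Category.comp_id _).symm) }, rfl, rfl⟩

namespace IsDeltaFunctor

variable {C} {T : Type*} [Category T] [HasZeroObject T] [HasShift T ℤ] [Preadditive T]
  [∀ n : ℤ, (shiftFunctor T n).Additive] [Pretriangulated T]
  {F : Stable C ⥤ T} (hF : IsDeltaFunctor C (toStable C ⋙ F))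
include hF

lemma additive_of_toStable_comp : F.Additive where
  map_add {X Y f g} := by
    have := hF.1
    obtain ⟨f, rfl⟩ := (toStable C).map_surjective f
    obtain ⟨g, rfl⟩ := (toStable C).map_surjective g
    rw [← (toStable C).map_add]
    exact (toStable C ⋙ F).map_add

lemma isIso_connecting_cosyzygySequence (M : Gor C) :
    IsIso (hF.connecting (isConflation_cosyzygySequence C M)) :=
  have := hF.additive_of_toStable_comp
  hF.isIso_connecting _ (F.map_isZero (isZero_toStable (cosyzygy C M).prop_I))

/-- The isomorphism `F(S(M)) ≅ F(M)[1]`. The standard triangle of `u : X ⟶ Y` is, up to rotation,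
the triangle of the conflation `Y ⟶ Z ⟶ S(X)`, and rotating replaces `F(u)[1]` by `-F(u)[1]`; hence
the sign. -/
def suspensionIso (M : Gor C) :
    F.obj ((toStable C).obj (cosyzygy C M).cosyz) ≅ (F.obj ((toStable C).obj M))⟦(1 : ℤ)⟧ :=
  haveI := hF.isIso_connecting_cosyzygySequence M
  (-asIso (hF.connecting (isConflation_cosyzygySequence C M)))

lemma suspensionIso_hom (M : Gor C) :
    (hF.suspensionIso M).hom = -hF.connecting (isConflation_cosyzygySequence C M) :=
  rfl

lemma suspensionIso_naturality {M N : Gor C} (f : M ⟶ N) :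
    F.map ((toStable C).map (cosyzygyMap C f)) ≫ (hF.suspensionIso N).hom =
      (hF.suspensionIso M).hom ≫ (F.map ((toStable C).map f))⟦(1 : ℤ)⟧' := by
  obtain ⟨φ, hφ₁, hφ₃⟩ := exists_cosyzygySequence_hom C f
  have h := hF.connecting_naturality (isConflation_cosyzygySequence C M)
    (isConflation_cosyzygySequence C N) φ
  rw [hφ₁, hφ₃] at h
  rw [suspensionIso_hom, suspensionIso_hom, Preadditive.comp_neg, Preadditive.neg_comp]
  exact congrArg (-·) h.symm

/-- The natural isomorphism `F ∘ S ≅ [1] ∘ F` with components `suspensionIso`. -/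
def suspensionNatIso : suspension C ⋙ F ≅ F ⋙ shiftFunctor T (1 : ℤ) :=
  CategoryTheory.Quotient.natIsoLift (stableRel C)
    (NatIso.ofComponents hF.suspensionIso hF.suspensionIso_naturality)

lemma suspensionIso_hom_comp_neg_map {X Y Z : Gor C} {u : X ⟶ Y} {v : Y ⟶ Z}
    {w : Z ⟶ (cosyzygy C X).cosyz} (h : IsStandard C u v w) (hvw : v ≫ w = 0) :
    (hF.suspensionIso X).hom ≫ (-(F.map ((toStable C).map u))⟦(1 : ℤ)⟧') =
      hF.connecting (h.isConflation hvw) := by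
  obtain ⟨φ, hφ₁, hφ₃⟩ := h.exists_cosyzygySequence_hom hvw
  have hnat := hF.connecting_naturality (isConflation_cosyzygySequence C X) (h.isConflation hvw) φ
  rw [hφ₁, hφ₃, CategoryTheory.Functor.map_id, Category.id_comp] at hnat
  rw [suspensionIso_hom, Preadditive.neg_comp_neg]
  exact hnat

lemma distinguished_of_isStandard {X Y Z : Gor C} {u : X ⟶ Y} {v : Y ⟶ Z}
    {w : Z ⟶ (cosyzygy C X).cosyz} (h : IsStandard C u v w) :
    Triangle.mk (F.map ((toStable C).map u)) (F.map ((toStable C).map v))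
      (F.map ((toStable C).map w) ≫ (hF.suspensionIso X).hom) ∈ distTriang T := by
  have hvw : v ≫ w = 0 := h.choose_spec.2.2
  rw [Pretriangulated.rotate_distinguished_triangle]
  exact distinguished_of_iso₃ (hF.connecting_distinguished (h.isConflation hvw))
    (hF.suspensionIso X) rfl (hF.suspensionIso_hom_comp_neg_map h hvw)

theorem isTriangleFunctor : IsTriangleFunctor C F := by
  refine ⟨hF.additive_of_toStable_comp, hF.suspensionNatIso, ?_⟩
  rintro X Y Z u v w ⟨X', Y', Z', u', v', w', h, a, b, c, hu, hv, hw⟩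
  have map_hw : F.map w ≫ F.map ((suspension C).map a.hom) =
      F.map c.hom ≫ F.map ((toStable C).map w') := (F.map_commSq (.mk hw)).w
  have hω : (F.map w ≫ hF.suspensionNatIso.hom.app X) ≫ (F.map a.hom)⟦(1 : ℤ)⟧' =
      F.map c.hom ≫ F.map ((toStable C).map w') ≫ (hF.suspensionIso X').hom := by
    rw [Category.assoc, ← Functor.comp_map, ← NatTrans.naturality, Functor.comp_map,
      reassoc_of% map_hw]
    exact Category.assoc _ _ _
  exact isomorphic_distinguished _ (hF.distinguished_of_isStandard h) _
    (Triangle.isoMk _ _ (F.mapIso a) (F.mapIso b) (F.mapIso c)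
      (F.map_commSq (.mk hu)).w (F.map_commSq (.mk hv)).w hω)

end IsDeltaFunctor

end RelSing

end

theorem proposition4p10_general {𝒜 : Type u} [Category.{v} 𝒜] [Abelian 𝒜] (C : ObjectProperty 𝒜)
    [C.IsClosedUnderFiniteProducts] :
    RelSing.IsDeltaFunctor C (RelSing.theta C) ∧
    (∀ M : RelSing.Gor C, C M.obj → IsZero ((RelSing.theta C).obj M)) ∧
    RelSing.IsTriangleFunctor C (RelSing.thetaStable C) :=
  have hθ := RelSing.isDeltaFunctor_theta C
  ⟨hθ, fun _ hM => RelSing.isZero_toDsg C hM, hθ.isTriangleFunctor (F := RelSing.thetaStable C)⟩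

theorem proposition4p10 {k : Type*} [Field k] {A : Type u} [Ring A] [Algebra k A]
    [Module.Finite k A] (C : ObjectProperty (FGModuleCat.{u} A))
    [C.IsClosedUnderFiniteProducts] [C.IsStableUnderRetracts] (hC : RelSing.IsAdmissible C) :
    haveI : IsNoetherianRing A := IsNoetherianRing.of_finite k A
    RelSing.IsDeltaFunctor C (RelSing.theta C) ∧
    (∀ M : RelSing.Gor C, C M.obj → IsZero ((RelSing.theta C).obj M)) ∧
    RelSing.IsTriangleFunctor C (RelSing.thetaStable C) := by
  have : IsNoetherianRing A := IsNoetherianRing.of_finite k A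
  exact proposition4p10_general C
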